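/- Let $a_1,a_2,a_3\in\mathbb C\setminus\{0\}$ and let $$A=\begin{bmatrix}0&a_1&0&0\\a_1^{-1}&0&a_2&0\\0&a_2^{-1}&0&a_3\\0&0&a_3^{-1}&0\end{bmatrix}$$ be the corresponding $4\times4$ reciprocal matrix. Put $A_j=\frac{|a_j|^2+|a_j|^{-2}}{2}$ for $j=1,2,3$ (so $A_j=\frac{a_j^2+a_j^{-2}}2$ if $a_j>0$). Call a subset of $\mathbb C$ bi-elliptical if it is the convex hull of two non-degenerate ellipses (circles being allowed) that have distinct centers and neither of which is contained in the closed elliptical disk bounded by the other. Then the numerical range $W(A)=\{\langle Ax,x\rangle : x\in\mathbb C^4,\ \|x\|=1\}$ is bi-elliptical if and only if $$A_1=A_3>1\quad\text{and}\quad A_2=1.$$ Moreover, $A_1=A_3>1$ is equivalent to: $|a_1|=|a_3|\neq1$ or $|a_1|=|a_3|^{-1}\neq1$; and $A_2=1$ is equivalent to $|a_2|=1$. In particular, for $a_1,a_2,a_3>0$, $W(A)$ is bi-elliptical if and only if $a_2=1$ and $a_1=a_3^{\pm1}\neq1$. -/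

import Mathlib

noncomputable section

/-- The numerical range `W(A) = {⟨Ax, x⟩ : x ∈ ℂⁿ, ‖x‖ = 1}`. The inner product of Mathlib is
linear in its second argument; with the inner product linear in the first one `⟨Ax, x⟩` is `inner ℂ x (A x)`. -/
def numericalRange {n : ℕ} (A : Matrix (Fin n) (Fin n) ℂ) : Set ℂ :=
  {z | ∃ x : EuclideanSpace ℂ (Fin n), ‖x‖ = 1 ∧ inner ℂ x (Matrix.toEuclideanLin A x) = z}

/-- The (non-degenerate) ellipse with center `c` and semi-axes of lengths `p` and `q`, the axis
of length `p` having direction `exp (iφ)`. Here `p, q > 0`; circles are ellipses. -/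
def IsEllipse (E : Set ℂ) (c : ℂ) : Prop :=
  ∃ φ p q : ℝ, 0 < p ∧ 0 < q ∧
    E = Set.range fun t : ℝ =>
      c + Complex.exp (φ * Complex.I) * ((p * Real.cos t : ℝ) + (q * Real.sin t : ℝ) * Complex.I)

/-- A set is bi-elliptical if it is the convex hull of two ellipses with distinct centers, neither
of which lies in the closed elliptical disk bounded by the other (otherwise the convex hull is just
an elliptical disk). -/
def IsBiElliptical (S : Set ℂ) : Prop :=
  ∃ (E₁ E₂ : Set ℂ) (c₁ c₂ : ℂ), IsEllipse E₁ c₁ ∧ IsEllipse E₂ c₂ ∧ c₁ ≠ c₂ ∧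
    ¬ E₁ ⊆ convexHull ℝ E₂ ∧ ¬ E₂ ⊆ convexHull ℝ E₁ ∧ S = convexHull ℝ (E₁ ∪ E₂)

/-- The 4-by-4 reciprocal matrix with superdiagonal entries `a₁, a₂, a₃`. -/
def reciprocalMatrix (a₁ a₂ a₃ : ℂ) : Matrix (Fin 4) (Fin 4) ℂ :=
  !![0, a₁, 0, 0;
     a₁⁻¹, 0, a₂, 0;
     0, a₂⁻¹, 0, a₃;
     0, 0, a₃⁻¹, 0]

/-- The quantity `(|a|² + |a|⁻²) / 2`, which is `(a² + a⁻²) / 2` for `a > 0`. -/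
def reciprocalMean (a : ℂ) : ℝ := (‖a‖ ^ 2 + (‖a‖ ^ 2)⁻¹) / 2

end

/-! A compact convex set is determined by its support function. For W(A) this is the largest root m
of x⁴ - (s₁ + s₂ + s₃)x² + s₁s₃, where s_j = (A_j + cos 2θ)/2
(`isGreatest_directionalPart_numericalRange`); for an ellipse with center c it is ℓ(θ) + √Q(θ),
where ℓ is the component of c and Q > 0 has period π.

If A₁ = A₃ and A₂ = 1, then s₂ = cos² θ, the quartic splits into two quadratics, and m is the
maximum of the support functions of two ellipses with centers ±1/2.

Conversely, one of the two ellipses has c ≠ 0 and determines W(A) on an open set of directions. By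
analyticity ℓ + √Q is a root for every θ, and θ ↦ θ + π makes -ℓ + √Q a root too. Vieta's relations
then turn 4(A₁ + cos 2θ)(A₃ + cos 2θ) into the square of an affine function of cos 2θ and sin 2θ,
which forces the parameters (`parameters_of_ellipse_root`). -/

/-! ### Support functions and convex hulls -/

/-- The real linear functional `z ↦ Re (exp (-iθ) z)`, the component of `z` in direction `θ`. -/
noncomputable def directionalPart (θ : ℝ) (z : ℂ) : ℝ := Real.cos θ * z.re + Real.sin θ * z.im

lemma directionalPart_add_pi (θ : ℝ) (z : ℂ) :
    directionalPart (θ + Real.pi) z = -directionalPart θ z := by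
  simp only [directionalPart, Real.cos_add_pi, Real.sin_add_pi]; ring

lemma directionalPart_add (θ : ℝ) (z w : ℂ) :
    directionalPart θ (z + w) = directionalPart θ z + directionalPart θ w := by
  simp only [directionalPart, Complex.add_re, Complex.add_im]; ring

lemma isGreatest_image_convexHull {S : Set ℂ} {θ m : ℝ}
    (h : IsGreatest (directionalPart θ '' S) m) :
    IsGreatest (directionalPart θ '' convexHull ℝ S) m := by
  refine ⟨Set.image_mono (subset_convexHull ℝ S) h.1, ?_⟩
  rintro _ ⟨z, hz, rfl⟩
  have hconv : Convex ℝ {z : ℂ | directionalPart θ z ≤ m} := by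
    intro x hx y hy a b ha hb hab
    simp only [Set.mem_ofPred_eq, directionalPart] at *
    simp only [Complex.add_re, Complex.add_im, Complex.real_smul, Complex.re_ofReal_mul,
      Complex.im_ofReal_mul]
    calc _ = a * (Real.cos θ * x.re + Real.sin θ * x.im)
          + b * (Real.cos θ * y.re + Real.sin θ * y.im) := by ring
      _ ≤ a * m + b * m := by gcongr
      _ = m := by rw [← add_mul, hab, one_mul]
  exact convexHull_min (fun x hx => h.2 ⟨x, hx, rfl⟩) hconv hz

/-- A point outside a closed convex set is strictly separated from it by a direction. -/
lemma exists_directionalPart_lt {S : Set ℂ} (hS : Convex ℝ S) (hc : IsClosed S)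
    {z : ℂ} (hz : z ∉ S) : ∃ θ, ∀ w ∈ S, directionalPart θ w < directionalPart θ z := by
  obtain ⟨f, u, hf, hu⟩ := geometric_hahn_banach_closed_point hS hc hz
  -- The gradient of `f` is the vector `f 1 + i f I`; its argument is the required direction.
  have key : ∀ w, f w = ‖(⟨f 1, f Complex.I⟩ : ℂ)‖ *
      directionalPart (Complex.arg ⟨f 1, f Complex.I⟩) w := by
    intro w
    have h1 := Complex.norm_mul_cos_arg (⟨f 1, f Complex.I⟩ : ℂ)
    have h2 := Complex.norm_mul_sin_arg (⟨f 1, f Complex.I⟩ : ℂ)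
    have h3 : f w = w.re * f 1 + w.im * f Complex.I := by
      conv_lhs => rw [← Complex.re_add_im w]
      have e : (w.re : ℂ) + w.im * Complex.I = w.re • (1 : ℂ) + w.im • Complex.I := by simp
      rw [e, map_add, map_smul, map_smul]; simp
    rw [h3, directionalPart]
    simp only at h1 h2
    linear_combination -w.re * h1 - w.im * h2
  refine ⟨Complex.arg ⟨f 1, f Complex.I⟩, fun w hw => ?_⟩
  have := (hf w hw).trans hu
  rw [key w, key z] at this
  exact lt_of_mul_lt_mul_left this (norm_nonneg _)

/-- Closed convex sets with the same support function are equal. -/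
lemma eq_of_isGreatest_directionalPart {S T : Set ℂ} (hS : Convex ℝ S) (hSc : IsClosed S)
    (hT : Convex ℝ T) (hTc : IsClosed T)
    (h : ∀ θ, ∃ m, IsGreatest (directionalPart θ '' S) m ∧ IsGreatest (directionalPart θ '' T) m) :
    S = T := by
  apply Set.Subset.antisymm
  · intro z hz
    by_contra hn
    obtain ⟨θ, hθ⟩ := exists_directionalPart_lt hT hTc hn
    obtain ⟨m, h1, ⟨w, hw, rfl⟩, -⟩ := h θ
    exact absurd (h1.2 ⟨z, hz, rfl⟩) (not_le.2 (hθ w hw))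
  · intro z hz
    by_contra hn
    obtain ⟨θ, hθ⟩ := exists_directionalPart_lt hS hSc hn
    obtain ⟨m, ⟨⟨w, hw, rfl⟩, -⟩, h1⟩ := h θ
    exact absurd (h1.2 ⟨z, hz, rfl⟩) (not_le.2 (hθ w hw))

/-- Relative to the center the functional is a cos t + b sin t, so Cauchy–Schwarz bounds it by |a +
ib|, attained at t = arg(a + ib). -/
lemma isGreatest_directionalPart_ellipse (c : ℂ) (φ p q θ : ℝ) :
    IsGreatest (directionalPart θ '' Set.range fun t : ℝ =>
      c + Complex.exp (φ * Complex.I) * ((p * Real.cos t : ℝ) + (q * Real.sin t : ℝ) * Complex.I))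
      (directionalPart θ c
        + √((p * Real.cos (θ - φ)) ^ 2 + (q * Real.sin (θ - φ)) ^ 2)) := by
  set a := p * Real.cos (θ - φ) with ha
  set b := q * Real.sin (θ - φ) with hb
  have key : ∀ t : ℝ, directionalPart θ (c + Complex.exp (φ * Complex.I) *
      ((p * Real.cos t : ℝ) + (q * Real.sin t : ℝ) * Complex.I))
      = directionalPart θ c + (a * Real.cos t + b * Real.sin t) := by
    intro t
    rw [directionalPart_add, ha, hb, Real.cos_sub, Real.sin_sub]
    congr 1
    simp only [directionalPart, Complex.mul_re, Complex.mul_im, Complex.exp_ofReal_mul_I_re,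
      Complex.exp_ofReal_mul_I_im, Complex.add_re, Complex.add_im, Complex.ofReal_re,
      Complex.ofReal_im, Complex.I_re, Complex.I_im]
    ring
  constructor
  · refine ⟨_, ⟨Complex.arg ⟨a, b⟩, rfl⟩, ?_⟩
    simp only [key]
    congr 1
    have h1 := Complex.norm_mul_cos_arg (⟨a, b⟩ : ℂ)
    have h2 := Complex.norm_mul_sin_arg (⟨a, b⟩ : ℂ)
    have h3 : ‖(⟨a, b⟩ : ℂ)‖ = √(a ^ 2 + b ^ 2) := by
      rw [Complex.norm_def, Complex.normSq_mk]; congr 1; ring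
    rw [← h3]
    simp only at h1 h2
    linear_combination -Real.cos (Complex.arg ⟨a, b⟩) * h1 - Real.sin (Complex.arg ⟨a, b⟩) * h2
      + ‖(⟨a, b⟩ : ℂ)‖ * Real.sin_sq_add_cos_sq (Complex.arg ⟨a, b⟩)
  · rintro _ ⟨_, ⟨t, rfl⟩, rfl⟩
    simp only [key]
    gcongr
    apply Real.le_sqrt_of_sq_le
    nlinarith [sq_nonneg (a * Real.sin t - b * Real.cos t), Real.sin_sq_add_cos_sq t]

lemma isCompact_range_ellipse (c : ℂ) (φ p q : ℝ) :
    IsCompact (Set.range fun t : ℝ =>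
      c + Complex.exp (φ * Complex.I) *
        ((p * Real.cos t : ℝ) + (q * Real.sin t : ℝ) * Complex.I)) := by
  refine Function.Periodic.compact_of_continuous (c := 2 * Real.pi) ?_
    Real.two_pi_pos.ne' ?_
  · intro t; simp
  · fun_prop

lemma IsEllipse.isCompact {E : Set ℂ} {c : ℂ} (h : IsEllipse E c) : IsCompact E := by
  obtain ⟨φ, p, q, -, -, rfl⟩ := h
  exact isCompact_range_ellipse c φ p q

/-- In a finite-dimensional space the convex hull of a compact set is compact, by Carathéodory. -/
lemma IsCompact.convexHull_of_finiteDimensional {E : Type*} [NormedAddCommGroup E]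
    [NormedSpace ℝ E] [FiniteDimensional ℝ E] {S : Set E} (hS : IsCompact S) :
    IsCompact (convexHull ℝ S) := by
  let F : (k : ℕ) → (Fin k → ℝ) × (Fin k → E) → E := fun k p => ∑ i, p.1 i • p.2 i
  -- Carathéodory needs at most `finrank + 1` points, hence the range up to `finrank + 2`; k = 0
  -- contributes nothing, as its simplex is empty.
  have heq : convexHull ℝ S = ⋃ k ∈ Finset.range (Module.finrank ℝ E + 2),
      F k '' (stdSimplex ℝ (Fin k) ×ˢ Set.univ.pi fun _ => S) := by
    apply Set.Subset.antisymm
    · intro x hx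
      obtain ⟨ι, _, z, w, hz, hind, hw, hw1, rfl⟩ := eq_pos_convex_span_of_mem_convexHull hx
      have hcard : Fintype.card ι ≤ Module.finrank ℝ E + 1 :=
        hind.card_le_finrank_succ.trans (by gcongr; exact Submodule.finrank_le _)
      let e := Fintype.equivFin ι
      simp only [Set.mem_iUnion]
      refine ⟨Fintype.card ι, Finset.mem_range.2 (by omega), (w ∘ e.symm, z ∘ e.symm),
        ⟨⟨fun i => (hw _).le, ?_⟩, fun i _ => hz ⟨_, rfl⟩⟩, ?_⟩
      · exact (Equiv.sum_comp e.symm w).trans hw1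
      · exact Equiv.sum_comp e.symm fun i => w i • z i
    · simp only [Set.iUnion_subset_iff]
      rintro k - _ ⟨⟨w, z⟩, ⟨⟨hw0, hw1⟩, hz⟩, rfl⟩
      exact (convex_convexHull ℝ S).sum_mem (fun i _ => hw0 i) hw1
        fun i _ => subset_convexHull ℝ S (hz i trivial)
  rw [heq]
  refine Finset.isCompact_biUnion _ fun k _ => ?_
  exact ((isCompact_stdSimplex ℝ (Fin k)).prod (isCompact_univ_pi fun _ => hS)).image
    (by fun_prop)

/-! ### Compactness and convexity of the numerical range -/

lemma isCompact_numericalRange {n : ℕ} (A : Matrix (Fin n) (Fin n) ℂ) :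
    IsCompact (numericalRange A) := by
  have : numericalRange A = (fun x : EuclideanSpace ℂ (Fin n) =>
      inner ℂ x (Matrix.toEuclideanLin A x)) '' Metric.sphere 0 1 := by
    ext z; simp [numericalRange]
  rw [this]
  refine (isCompact_sphere _ _).image ?_
  have : Continuous (Matrix.toEuclideanLin A) := LinearMap.continuous_of_finiteDimensional _
  fun_prop

lemma div_norm_sq_mem_numericalRange {n : ℕ} (A : Matrix (Fin n) (Fin n) ℂ)
    {x : EuclideanSpace ℂ (Fin n)} (hx : x ≠ 0) :
    inner ℂ x (Matrix.toEuclideanLin A x) / (‖x‖ : ℂ) ^ 2 ∈ numericalRange A := by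
  have h : ‖x‖ ≠ 0 := norm_ne_zero_iff.2 hx
  refine ⟨((‖x‖⁻¹ : ℝ) : ℂ) • x, ?_, ?_⟩
  · rw [norm_smul]; simp [h]
  · rw [map_smul, inner_smul_left, inner_smul_right]
    simp
    field_simp

/-- If `⟨x, T x⟩` is real on the real span of two unit vectors, with values `0` and `1` at them,
then every `s ∈ [0, 1]` is a value of `⟨x, T x⟩ / ‖x‖²` at some nonzero `x`. -/
lemma exists_inner_eq_of_im_eq_zero {E : Type*} [NormedAddCommGroup E] [InnerProductSpace ℂ E]
    (T : E →ₗ[ℂ] E) {f g : E} (hf : ‖f‖ = 1)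
    (h0 : inner ℂ f (T f) = 0) (h1 : inner ℂ g (T g) = (‖g‖ : ℂ) ^ 2) (hg : ‖g‖ = 1)
    (him : (inner ℂ f (T g) + inner ℂ g (T f)).im = 0) {s : ℝ} (hs : s ∈ Set.Icc (0 : ℝ) 1) :
    ∃ x : E, x ≠ 0 ∧ inner ℂ x (T x) = s * (‖x‖ : ℂ) ^ 2 := by
  -- If the combination vanished with t ≠ 0, then g would be a multiple of f and ⟨g, Tg⟩ would be 0
  -- instead of 1.
  have hne : ∀ t : ℝ, ((1 - t : ℝ) : ℂ) • f + (t : ℂ) • g ≠ 0 := by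
    intro t ht
    by_cases h : t = 0
    · subst h
      simp at ht; simp [ht] at hf
    · have ht' : (t : ℂ) ≠ 0 := by exact_mod_cast h
      have : g = (-(t : ℂ)⁻¹ * ((1 - t : ℝ) : ℂ)) • f := by
        have h2 : (t : ℂ) • g = -(((1 - t : ℝ) : ℂ) • f) := by
          rw [eq_neg_iff_add_eq_zero, add_comm]; exact ht
        calc g = (t : ℂ)⁻¹ • (t : ℂ) • g := by rw [smul_smul, inv_mul_cancel₀ ht', one_smul]
          _ = _ := by rw [h2, smul_neg, smul_smul, neg_mul, neg_smul]
      rw [this, map_smul, inner_smul_left, inner_smul_right, h0, ← this, hg] at h1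
      simp at h1
  set r : ℝ := (inner ℂ f (T g) + inner ℂ g (T f)).re with hr
  have hrC : inner ℂ f (T g) + inner ℂ g (T f) = (r : ℂ) := by
    exact Complex.ext (by simp [hr]) (by simpa using him)
  let N : ℝ → ℝ := fun t => ‖((1 - t : ℝ) : ℂ) • f + (t : ℂ) • g‖ ^ 2
  have hN : ∀ t, N t ≠ 0 := fun t => pow_ne_zero _ (norm_ne_zero_iff.2 (hne t))
  have hcont : Continuous fun t : ℝ => (t ^ 2 + t * (1 - t) * r) / N t := by
    have : Continuous N := by fun_prop
    exact Continuous.div (by fun_prop) this hN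
  have hiv := intermediate_value_Icc (zero_le_one' ℝ) hcont.continuousOn
  have e0 : (0 ^ 2 + 0 * (1 - 0) * r) / N 0 = 0 := by simp
  have e1 : (1 ^ 2 + 1 * (1 - 1) * r) / N 1 = 1 := by simp [N, hg]
  rw [e0, e1] at hiv
  obtain ⟨t, -, ht⟩ := hiv hs
  refine ⟨_, hne t, ?_⟩
  have ht2 : t ^ 2 + t * (1 - t) * r = s * N t := by
    simp only at ht; rw [← ht, div_mul_cancel₀ _ (hN t)]
  have : inner ℂ (((1 - t : ℝ) : ℂ) • f + (t : ℂ) • g)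
      (T (((1 - t : ℝ) : ℂ) • f + (t : ℂ) • g)) = ((t ^ 2 + t * (1 - t) * r : ℝ) : ℂ) := by
    simp only [map_add, map_smul, inner_add_left, inner_add_right, inner_smul_left,
      inner_smul_right, h0, h1, hg, Complex.conj_ofReal]
    push_cast
    linear_combination (t : ℂ) * (1 - t) * hrC
  rw [this, ht2]
  simp [N]

/-- **Toeplitz–Hausdorff theorem**: the numerical range is convex. -/
theorem convex_numericalRange {n : ℕ} (A : Matrix (Fin n) (Fin n) ℂ) :
    Convex ℝ (numericalRange A) := by
  rw [convex_iff_segment_subset]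
  rintro z ⟨f, hf, hfz⟩ w ⟨g, hg, hgw⟩ _ ⟨a, b, ha, hb, hab, rfl⟩
  by_cases hzw : z = w
  · subst hzw
    rw [← add_smul, hab, one_smul]
    exact ⟨f, hf, hfz⟩
  have hd : w - z ≠ 0 := sub_ne_zero.2 (Ne.symm hzw)
  -- An affine change of the operator moves z and w to 0 and 1.
  let T : EuclideanSpace ℂ (Fin n) →ₗ[ℂ] EuclideanSpace ℂ (Fin n) :=
    (w - z)⁻¹ • (Matrix.toEuclideanLin A - z • LinearMap.id)
  have hT : ∀ x y, inner ℂ x (T y)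
      = (w - z)⁻¹ * (inner ℂ x (Matrix.toEuclideanLin A y) - z * inner ℂ x y) := by
    intro x y
    simp [T]
  have hTf : inner ℂ f (T f) = 0 := by
    rw [hT, hfz, inner_self_eq_norm_sq_to_K, hf]; simp
  have hTg : inner ℂ g (T g) = 1 := by
    rw [hT, hgw, inner_self_eq_norm_sq_to_K, hg]; simp [hd]
  -- The imaginary part equals Im(u(P - conj Q)), so u only has to cancel the argument of P - conj
  -- Q.
  obtain ⟨u, hu, huim⟩ : ∃ u : ℂ, ‖u‖ = 1 ∧
      (u * inner ℂ f (T g) + starRingEnd ℂ u * inner ℂ g (T f)).im = 0 := by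
    set P := inner ℂ f (T g)
    set Q := inner ℂ g (T f)
    let c : ℂ := P - starRingEnd ℂ Q
    refine ⟨Complex.exp (((-Complex.arg c : ℝ) : ℂ) * Complex.I),
      Complex.norm_exp_ofReal_mul_I _, ?_⟩
    have h1 := Complex.norm_mul_cos_arg c
    have h2 := Complex.norm_mul_sin_arg c
    have h3 : (P.im + Q.im) * Real.cos (Complex.arg c)
        - (P.re - Q.re) * Real.sin (Complex.arg c) = 0 := by
      have e1 : c.re = P.re - Q.re := by simp [c]
      have e2 : c.im = P.im + Q.im := by simp [c]
      rw [← e1, ← e2, ← h1, ← h2]; ring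
    simp only [Complex.add_im, Complex.mul_im, Complex.conj_re, Complex.conj_im,
      Complex.exp_ofReal_mul_I_re, Complex.exp_ofReal_mul_I_im, Real.cos_neg, Real.sin_neg]
    linear_combination h3
  have hcu : starRingEnd ℂ u * u = 1 := by
    rw [mul_comm, Complex.mul_conj, Complex.normSq_eq_norm_sq, hu]; simp
  have hug : ‖u • g‖ = 1 := by rw [norm_smul, hu, hg, one_mul]
  obtain ⟨x, hx, hxT⟩ := exists_inner_eq_of_im_eq_zero T (g := u • g) (s := b) hf hTf
    (by rw [map_smul, inner_smul_left, inner_smul_right, hTg, hug]; simp [hcu]) hug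
    (by rw [map_smul, inner_smul_left, inner_smul_right]; exact huim)
    ⟨hb, by linarith⟩
  have hxn : (‖x‖ : ℂ) ^ 2 ≠ 0 := by simpa using hx
  convert div_norm_sq_mem_numericalRange A hx using 1
  rw [hT, inner_self_eq_norm_sq_to_K] at hxT
  have haC : (a : ℂ) = 1 - b := by rw [← Complex.ofReal_one, ← hab]; push_cast; ring
  rw [eq_div_iff hxn, Complex.real_smul, Complex.real_smul, haC]
  have : inner ℂ x (Matrix.toEuclideanLin A x) = (w - z) * (b * (‖x‖ : ℂ) ^ 2)
      + z * (‖x‖ : ℂ) ^ 2 := by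
    rw [← hxT, ← mul_assoc, mul_inv_cancel₀ hd]; simp
  rw [this]; ring

/-! ### Support function of the numerical range of a reciprocal matrix -/

/-- Bound on the quadratic form of a hermitian tridiagonal matrix with zero diagonal, by the larger
root of its characteristic polynomial. -/
lemma tridiagonal_form_le {s₁ s₂ s₃ m : ℝ} (h₁ : 0 ≤ s₁) (h₂ : 0 ≤ s₂) (h₃ : 0 ≤ s₃) (hm : 0 ≤ m)
    (hroot : m ^ 4 - (s₁ + s₂ + s₃) * m ^ 2 + s₁ * s₃ = 0)
    (hlarge : s₁ + s₂ + s₃ ≤ 2 * m ^ 2) (x₀ x₁ x₂ x₃ : ℝ) :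
    2 * (√s₁ * x₀ * x₁ + √s₂ * x₁ * x₂ + √s₃ * x₂ * x₃)
      ≤ m * (x₀ ^ 2 + x₁ ^ 2 + x₂ ^ 2 + x₃ ^ 2) := by
  rcases hm.eq_or_lt with rfl | hm
  · have e₁ : s₁ = 0 := by linarith
    have e₂ : s₂ = 0 := by linarith
    have e₃ : s₃ = 0 := by linarith
    simp [e₁, e₂, e₃]
  have k₁ := Real.sq_sqrt h₁
  have k₂ := Real.sq_sqrt h₂
  have k₃ := Real.sq_sqrt h₃
  have hprod : (m ^ 2 - s₁) * (m ^ 2 - s₃) = s₂ * m ^ 2 := by linear_combination hroot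
  have hpos : 0 ≤ s₂ * m ^ 2 := by positivity
  -- The product of m² - s₁ and m² - s₃ is nonnegative by `hprod`, their sum by `hlarge`, so neither
  -- factor is negative.
  have u : 0 ≤ m ^ 2 - s₁ := by
    by_contra hn
    nlinarith
  have v : 0 ≤ m ^ 2 - s₃ := by
    by_contra hn
    nlinarith
  have ku := Real.sq_sqrt u
  have kv := Real.sq_sqrt v
  have huv : √(m ^ 2 - s₁) * √(m ^ 2 - s₃) = √s₂ * m := by
    rw [← Real.sqrt_mul u, hprod, Real.sqrt_mul h₂, Real.sqrt_sq hm.le]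
  have key : m * (m * (x₀ ^ 2 + x₁ ^ 2 + x₂ ^ 2 + x₃ ^ 2)
      - 2 * (√s₁ * x₀ * x₁ + √s₂ * x₁ * x₂ + √s₃ * x₂ * x₃))
      = (m * x₀ - √s₁ * x₁) ^ 2 + (m * x₃ - √s₃ * x₂) ^ 2
        + (√(m ^ 2 - s₁) * x₁ - √(m ^ 2 - s₃) * x₂) ^ 2 := by
    linear_combination 2 * x₁ * x₂ * huv - x₁ ^ 2 * ku - x₂ ^ 2 * kv - x₁ ^ 2 * k₁ - x₂ ^ 2 * k₃
  have : 0 ≤ m * (m * (x₀ ^ 2 + x₁ ^ 2 + x₂ ^ 2 + x₃ ^ 2)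
      - 2 * (√s₁ * x₀ * x₁ + √s₂ * x₁ * x₂ + √s₃ * x₂ * x₃)) := by
    rw [key]; positivity
  linarith [nonneg_of_mul_nonneg_right this hm]

/-- The characteristic determinant depends only on the moduli of the entries, and `hroot` says that
it vanishes at m. The eigenvector shows that the bound of `tridiagonal_form_le` is attained. -/
lemma exists_tridiagonal_eigenvector (g₁ g₂ g₃ : ℂ) {m : ℝ}
    (hroot : m ^ 4 - (‖g₁‖ ^ 2 + ‖g₂‖ ^ 2 + ‖g₃‖ ^ 2) * m ^ 2 + ‖g₁‖ ^ 2 * ‖g₃‖ ^ 2 = 0) :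
    ∃ x : Fin 4 → ℂ, x ≠ 0 ∧
      g₁ * x 1 = m * x 0 ∧
      starRingEnd ℂ g₁ * x 0 + g₂ * x 2 = m * x 1 ∧
      starRingEnd ℂ g₂ * x 1 + g₃ * x 3 = m * x 2 ∧
      starRingEnd ℂ g₃ * x 2 = m * x 3 := by
  have hdet : (!![-(m : ℂ), g₁, 0, 0;
     starRingEnd ℂ g₁, -(m : ℂ), g₂, 0;
     0, starRingEnd ℂ g₂, -(m : ℂ), g₃;
     0, 0, starRingEnd ℂ g₃, -(m : ℂ)]).det = 0 := by
    have e : ((m ^ 4 - (‖g₁‖ ^ 2 + ‖g₂‖ ^ 2 + ‖g₃‖ ^ 2) * m ^ 2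
        + ‖g₁‖ ^ 2 * ‖g₃‖ ^ 2 : ℝ) : ℂ) = 0 := by rw [hroot]; simp
    have k : ∀ g : ℂ, ((‖g‖ : ℂ)) ^ 2 = g * starRingEnd ℂ g := fun g => by
      rw [Complex.mul_conj, Complex.normSq_eq_norm_sq]; simp
    push_cast at e
    rw [k, k, k] at e
    simp [Matrix.det_succ_row_zero, Fin.sum_univ_succ, Fin.succAbove]
    linear_combination e
  obtain ⟨x, hx, h⟩ := Matrix.exists_mulVec_eq_zero_iff.2 hdet
  have h0 := congrFun h 0
  have h1 := congrFun h 1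
  have h2 := congrFun h 2
  have h3 := congrFun h 3
  simp [Matrix.mulVec, dotProduct, Fin.sum_univ_succ] at h0 h1 h2 h3
  exact ⟨x, hx, by linear_combination h0, by linear_combination h1,
    by linear_combination h2, by linear_combination h3⟩

/-- The off-diagonal entries of the hermitian part of `exp (-iθ) A`. -/
noncomputable def rotatedEntry (θ : ℝ) (a : ℂ) : ℂ :=
  (Complex.exp (-θ * Complex.I) * a + starRingEnd ℂ (Complex.exp (-θ * Complex.I) * a⁻¹)) / 2

/-- This is where reciprocity enters: in the cross term of |u + v|² the factors a and a⁻¹ cancel,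
leaving 2 cos 2θ. -/
lemma norm_rotatedEntry_sq (θ : ℝ) {a : ℂ} (ha : a ≠ 0) :
    ‖rotatedEntry θ a‖ ^ 2 = (reciprocalMean a + Real.cos (2 * θ)) / 2 := by
  have h1 : ‖Complex.exp (-θ * Complex.I)‖ = 1 := by
    have := Complex.norm_exp_ofReal_mul_I (-θ); push_cast at this; exact this
  have h2 : (Complex.exp (-θ * Complex.I) * a) *
      starRingEnd ℂ (starRingEnd ℂ (Complex.exp (-θ * Complex.I) * a⁻¹))
      = Complex.exp (((-(2 * θ) : ℝ) : ℂ) * Complex.I) := by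
    rw [Complex.conj_conj]
    calc _ = Complex.exp (-θ * Complex.I) * Complex.exp (-θ * Complex.I) * (a * a⁻¹) := by ring
      _ = _ := by rw [mul_inv_cancel₀ ha, mul_one, ← Complex.exp_add]; congr 1; push_cast; ring
  rw [rotatedEntry, norm_div, div_pow, ← Complex.normSq_eq_norm_sq, Complex.normSq_add, h2,
    Complex.exp_ofReal_mul_I_re, Complex.normSq_conj, Complex.normSq_eq_norm_sq,
    Complex.normSq_eq_norm_sq, norm_mul, norm_mul, h1, norm_inv, Real.cos_neg, reciprocalMean]
  simp
  ring

lemma directionalPart_pair (θ : ℝ) (a x y : ℂ) :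
    directionalPart θ (starRingEnd ℂ x * (a * y) + starRingEnd ℂ y * (a⁻¹ * x))
      = 2 * (starRingEnd ℂ x * (rotatedEntry θ a * y)).re := by
  have h : rotatedEntry θ a = ⟨(Real.cos θ * a.re + Real.sin θ * a.im + Real.cos θ * a⁻¹.re
      + Real.sin θ * a⁻¹.im) / 2, (Real.cos θ * a.im - Real.sin θ * a.re - Real.cos θ * a⁻¹.im
      + Real.sin θ * a⁻¹.re) / 2⟩ := by
    have e : (-θ : ℂ) * Complex.I = ((-θ : ℝ) : ℂ) * Complex.I := by push_cast; ring
    rw [rotatedEntry, e]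
    apply Complex.ext
    · rw [Complex.div_ofNat_re]
      simp only [Complex.add_re, Complex.conj_re, Complex.mul_re, Complex.exp_ofReal_mul_I_re,
        Complex.exp_ofReal_mul_I_im, Real.cos_neg, Real.sin_neg]
      ring
    · rw [Complex.div_ofNat_im]
      simp only [Complex.add_im, Complex.conj_im, Complex.mul_im, Complex.exp_ofReal_mul_I_re,
        Complex.exp_ofReal_mul_I_im, Real.cos_neg, Real.sin_neg]
      ring
  rw [h]
  generalize a⁻¹ = b
  simp only [directionalPart, Complex.add_re, Complex.add_im, Complex.mul_re, Complex.mul_im,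
    Complex.conj_re, Complex.conj_im]
  ring

lemma directionalPart_inner_reciprocalMatrix (θ : ℝ) (a₁ a₂ a₃ : ℂ)
    (x : EuclideanSpace ℂ (Fin 4)) :
    directionalPart θ (inner ℂ x (Matrix.toEuclideanLin (reciprocalMatrix a₁ a₂ a₃) x))
      = 2 * (starRingEnd ℂ (x 0) * (rotatedEntry θ a₁ * x 1)).re
        + 2 * (starRingEnd ℂ (x 1) * (rotatedEntry θ a₂ * x 2)).re
        + 2 * (starRingEnd ℂ (x 2) * (rotatedEntry θ a₃ * x 3)).re := by
  have h : inner ℂ x (Matrix.toEuclideanLin (reciprocalMatrix a₁ a₂ a₃) x)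
      = (starRingEnd ℂ (x 0) * (a₁ * x 1) + starRingEnd ℂ (x 1) * (a₁⁻¹ * x 0))
        + (starRingEnd ℂ (x 1) * (a₂ * x 2) + starRingEnd ℂ (x 2) * (a₂⁻¹ * x 1))
        + (starRingEnd ℂ (x 2) * (a₃ * x 3) + starRingEnd ℂ (x 3) * (a₃⁻¹ * x 2)) := by
    simp [PiLp.inner_apply, Matrix.toLpLin_apply, dotProduct, reciprocalMatrix,
      Fin.sum_univ_succ]
    ring
  rw [h, directionalPart_add, directionalPart_add, directionalPart_pair, directionalPart_pair,
    directionalPart_pair]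

/-- The support function of the numerical range of a reciprocal matrix: it is the largest root of
the characteristic polynomial of the hermitian part of `exp (-iθ) A`. -/
lemma isGreatest_directionalPart_numericalRange {a₁ a₂ a₃ : ℂ} (h₁ : a₁ ≠ 0) (h₂ : a₂ ≠ 0)
    (h₃ : a₃ ≠ 0) {θ m s₁ s₂ s₃ : ℝ} (hs₁ : s₁ = (reciprocalMean a₁ + Real.cos (2 * θ)) / 2)
    (hs₂ : s₂ = (reciprocalMean a₂ + Real.cos (2 * θ)) / 2)
    (hs₃ : s₃ = (reciprocalMean a₃ + Real.cos (2 * θ)) / 2) (hm : 0 ≤ m)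
    (hroot : m ^ 4 - (s₁ + s₂ + s₃) * m ^ 2 + s₁ * s₃ = 0)
    (hlarge : s₁ + s₂ + s₃ ≤ 2 * m ^ 2) :
    IsGreatest (directionalPart θ '' numericalRange (reciprocalMatrix a₁ a₂ a₃)) m := by
  rw [← norm_rotatedEntry_sq θ h₁] at hs₁
  rw [← norm_rotatedEntry_sq θ h₂] at hs₂
  rw [← norm_rotatedEntry_sq θ h₃] at hs₃
  constructor
  · obtain ⟨x, hx, e0, e1, e2, e3⟩ := exists_tridiagonal_eigenvector (rotatedEntry θ a₁)
      (rotatedEntry θ a₂) (rotatedEntry θ a₃) (m := m) (by rw [← hs₁, ← hs₂, ← hs₃]; exact hroot)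
    let y : EuclideanSpace ℂ (Fin 4) := WithLp.toLp 2 x
    have hy : y ≠ 0 := fun h => hx (by simpa [y] using h)
    refine ⟨_, div_norm_sq_mem_numericalRange _ hy, ?_⟩
    have hn : ‖y‖ ^ 2 ≠ 0 := pow_ne_zero _ (norm_ne_zero_iff.2 hy)
    have hd : ∀ (z : ℂ) (r : ℝ), directionalPart θ (z / (r : ℂ)) = directionalPart θ z / r := by
      intro z r
      simp only [directionalPart, Complex.div_ofReal_re, Complex.div_ofReal_im]; ring
    have hc : ((‖y‖ : ℂ)) ^ 2 = ((‖y‖ ^ 2 : ℝ) : ℂ) := by push_cast; rfl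
    rw [hc, hd, div_eq_iff hn, directionalPart_inner_reciprocalMatrix,
      EuclideanSpace.norm_sq_eq, Fin.sum_univ_four]
    simp only [y]
    -- Pairing each eigenvector equation with the conjugate coordinate and adding gives the
    -- quadratic form the value m‖x‖².
    have f0 := congrArg (fun z => (starRingEnd ℂ (x 0) * z).re) e0
    have f1 := congrArg (fun z => (starRingEnd ℂ (x 1) * z).re) e1
    have f2 := congrArg (fun z => (starRingEnd ℂ (x 2) * z).re) e2
    have f3 := congrArg (fun z => (starRingEnd ℂ (x 3) * z).re) e3
    simp only [← Complex.normSq_eq_norm_sq, Complex.normSq_apply, Complex.add_re, Complex.add_im,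
      Complex.mul_re, Complex.mul_im, Complex.conj_re, Complex.conj_im, Complex.ofReal_re,
      Complex.ofReal_im] at f0 f1 f2 f3 ⊢
    linear_combination f0 + f1 + f2 + f3
  · rintro _ ⟨_, ⟨x, hx, rfl⟩, rfl⟩
    rw [directionalPart_inner_reciprocalMatrix]
    have hre : ∀ (g a b : ℂ), (starRingEnd ℂ a * (g * b)).re ≤ ‖g‖ * ‖a‖ * ‖b‖ := fun g a b => by
      refine (Complex.re_le_norm _).trans (le_of_eq ?_)
      rw [norm_mul, norm_mul, Complex.norm_conj]; ring
    have hb := tridiagonal_form_le (s₁ := s₁) (s₂ := s₂) (s₃ := s₃) (by rw [hs₁]; positivity)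
      (by rw [hs₂]; positivity) (by rw [hs₃]; positivity) hm hroot hlarge
      ‖x 0‖ ‖x 1‖ ‖x 2‖ ‖x 3‖
    have hn := EuclideanSpace.norm_sq_eq x
    rw [hx, Fin.sum_univ_four] at hn
    rw [← hn, hs₁, hs₂, hs₃, Real.sqrt_sq (norm_nonneg _), Real.sqrt_sq (norm_nonneg _),
      Real.sqrt_sq (norm_nonneg _)] at hb
    linarith [hre (rotatedEntry θ a₁) (x 0) (x 1), hre (rotatedEntry θ a₂) (x 1) (x 2),
      hre (rotatedEntry θ a₃) (x 2) (x 3)]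

/-! ### Elementary properties of A_j -/

lemma reciprocalMean_sub_one {a : ℂ} (ha : a ≠ 0) :
    reciprocalMean a - 1 = (‖a‖ ^ 2 - 1) ^ 2 / (2 * ‖a‖ ^ 2) := by
  have : ‖a‖ ≠ 0 := norm_ne_zero_iff.2 ha
  rw [reciprocalMean]; field_simp; ring

lemma one_le_reciprocalMean {a : ℂ} (ha : a ≠ 0) : 1 ≤ reciprocalMean a := by
  have : 0 ≤ reciprocalMean a - 1 := by rw [reciprocalMean_sub_one ha]; positivity
  linarith

lemma reciprocalMean_eq_one_iff {a : ℂ} (ha : a ≠ 0) : reciprocalMean a = 1 ↔ ‖a‖ = 1 := by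
  have h : ‖a‖ ≠ 0 := norm_ne_zero_iff.2 ha
  rw [← sub_eq_zero, reciprocalMean_sub_one ha, div_eq_zero_iff, pow_eq_zero_iff two_ne_zero,
    sub_eq_zero, pow_eq_one_iff_of_nonneg (norm_nonneg _) two_ne_zero]
  simp [ha]

lemma one_lt_reciprocalMean_iff {a : ℂ} (ha : a ≠ 0) : 1 < reciprocalMean a ↔ ‖a‖ ≠ 1 := by
  rw [(one_le_reciprocalMean ha).lt_iff_ne, ne_comm, Ne, reciprocalMean_eq_one_iff ha]

lemma reciprocalMean_eq_iff {a b : ℂ} (ha : a ≠ 0) (hb : b ≠ 0) :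
    reciprocalMean a = reciprocalMean b ↔ ‖a‖ = ‖b‖ ∨ ‖a‖ = ‖b‖⁻¹ := by
  have h : 0 < ‖a‖ := norm_pos_iff.2 ha
  have k : 0 < ‖b‖ := norm_pos_iff.2 hb
  have key : reciprocalMean a - reciprocalMean b
      = (‖a‖ ^ 2 - ‖b‖ ^ 2) * ((‖a‖ * ‖b‖) ^ 2 - 1) / (2 * ‖a‖ ^ 2 * ‖b‖ ^ 2) := by
    rw [reciprocalMean, reciprocalMean]; field_simp; ring
  have hden : 2 * ‖a‖ ^ 2 * ‖b‖ ^ 2 ≠ 0 := by positivity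
  rw [← sub_eq_zero, key, div_eq_zero_iff, or_iff_left hden, mul_eq_zero, sub_eq_zero,
    sub_eq_zero, pow_left_inj₀ h.le k.le two_ne_zero,
    pow_eq_one_iff_of_nonneg (by positivity) two_ne_zero, mul_eq_one_iff_eq_inv₀ k.ne']

lemma reciprocalMean_eq_and_one_lt_iff {a b : ℂ} (ha : a ≠ 0) (hb : b ≠ 0) :
    (reciprocalMean a = reciprocalMean b ∧ 1 < reciprocalMean b) ↔
      (‖a‖ = ‖b‖ ∧ ‖b‖ ≠ 1) ∨ (‖a‖ = ‖b‖⁻¹ ∧ ‖b‖⁻¹ ≠ 1) := by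
  rw [reciprocalMean_eq_iff ha hb, one_lt_reciprocalMean_iff hb, or_and_right, Ne, Ne,
    inv_eq_one]

/-! ### Sufficiency of the parameter conditions -/

/-- An ellipse that reaches further than `E₂` in some direction is not contained in the elliptical
disk bounded by `E₂`. -/
lemma not_subset_convexHull_of_lt {E₁ E₂ : Set ℂ} {θ m₁ m₂ : ℝ}
    (h₁ : IsGreatest (directionalPart θ '' E₁) m₁) (h₂ : IsGreatest (directionalPart θ '' E₂) m₂)
    (h : m₂ < m₁) : ¬ E₁ ⊆ convexHull ℝ E₂ := by
  intro hsub
  obtain ⟨z, hz, hzm⟩ := h₁.1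
  have := (isGreatest_image_convexHull h₂).2 ⟨z, hsub hz, rfl⟩
  linarith

lemma isGreatest_image_convexHull_union {E₁ E₂ : Set ℂ} {θ m₁ m₂ : ℝ}
    (h₁ : IsGreatest (directionalPart θ '' E₁) m₁)
    (h₂ : IsGreatest (directionalPart θ '' E₂) m₂) :
    IsGreatest (directionalPart θ '' convexHull ℝ (E₁ ∪ E₂)) (max m₁ m₂) := by
  apply isGreatest_image_convexHull
  rw [Set.image_union]
  exact h₁.union h₂

lemma isBiElliptical_numericalRange {a₁ a₂ a₃ : ℂ} (h₁ : a₁ ≠ 0) (h₂ : a₂ ≠ 0) (h₃ : a₃ ≠ 0)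
    (h₁₃ : reciprocalMean a₁ = reciprocalMean a₃) (hlt : 1 < reciprocalMean a₃)
    (h22 : reciprocalMean a₂ = 1) :
    IsBiElliptical (numericalRange (reciprocalMatrix a₁ a₂ a₃)) := by
  set B := reciprocalMean a₃ with hB
  -- With s₂ = cos² θ and s₁ = s₃ the largest root solves m² - |cos θ| m - s₁ = 0, so m = |cos θ|/2
  -- + √(cos² θ/4 + s₁). The radicand is p² cos² θ + q² sin² θ.
  set p := √((2 * B + 3) / 4) with hp
  set q := √((B - 1) / 2) with hq
  have hp0 : 0 < p := Real.sqrt_pos.2 (by linarith)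
  have hq0 : 0 < q := Real.sqrt_pos.2 (by linarith)
  have hp2 : p ^ 2 = (2 * B + 3) / 4 := Real.sq_sqrt (by linarith)
  have hq2 : q ^ 2 = (B - 1) / 2 := Real.sq_sqrt (by linarith)
  have hE := isGreatest_directionalPart_ellipse (1 / 2) 0 p q
  have hE' := isGreatest_directionalPart_ellipse (-(1 / 2)) 0 p q
  have hell : ∀ c, IsEllipse (Set.range fun t : ℝ => c + Complex.exp ((0 : ℝ) * Complex.I) *
      ((p * Real.cos t : ℝ) + (q * Real.sin t : ℝ) * Complex.I)) c :=
    fun c => ⟨0, p, q, hp0, hq0, rfl⟩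
  have hneg : ∀ θ : ℝ, directionalPart θ (-(1 / 2)) = -(Real.cos θ / 2) := by
    intro θ; simp [directionalPart]; ring
  have hpos : ∀ θ : ℝ, directionalPart θ (1 / 2) = Real.cos θ / 2 := by
    intro θ; simp [directionalPart]; ring
  refine ⟨_, _, 1 / 2, -(1 / 2), hell _, hell _, by norm_num,
    not_subset_convexHull_of_lt (hE 0) (hE' 0) ?_,
    not_subset_convexHull_of_lt (hE' Real.pi) (hE Real.pi) ?_, ?_⟩
  · rw [hneg, hpos, Real.cos_zero]; linarith
  · rw [hneg, hpos, Real.cos_pi]; linarith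
  · refine eq_of_isGreatest_directionalPart (convex_numericalRange _)
      (isCompact_numericalRange _).isClosed (convex_convexHull ℝ _)
      ((isCompact_range_ellipse _ _ _ _).union
        (isCompact_range_ellipse _ _ _ _)).convexHull_of_finiteDimensional.isClosed fun θ => ?_
    refine ⟨_, ?_, isGreatest_image_convexHull_union (hE θ) (hE' θ)⟩
    rw [max_add_add_right, hpos, hneg, ← abs_eq_max_neg, sub_zero]
    set R := √((p * Real.cos θ) ^ 2 + (q * Real.sin θ) ^ 2) with hR
    have hR2 : R ^ 2 = (2 * B + 3) / 4 * Real.cos θ ^ 2 + (B - 1) / 2 * Real.sin θ ^ 2 := by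
      rw [hR, Real.sq_sqrt (by positivity), mul_pow, mul_pow, hp2, hq2]
    have hR0 : 0 ≤ R := Real.sqrt_nonneg _
    set u := |Real.cos θ / 2| with hu
    have hu0 : 0 ≤ u := abs_nonneg _
    have hu2 : 4 * u ^ 2 = Real.cos θ ^ 2 := by rw [hu, sq_abs]; ring
    have hs : Real.sin θ ^ 2 = 1 - 4 * u ^ 2 := by rw [hu2, Real.sin_sq]
    rw [hs, ← hu2] at hR2
    have hc : Real.cos (2 * θ) = 8 * u ^ 2 - 1 := by rw [Real.cos_two_mul, ← hu2]; ring
    -- Eliminating B in favour of u and R makes the root equation for m = u + R a polynomial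
    -- identity.
    have hBeq : B = 1 + 2 * R ^ 2 - 10 * u ^ 2 := by linear_combination -2 * hR2
    refine isGreatest_directionalPart_numericalRange h₁ h₂ h₃ rfl rfl rfl (by positivity) ?_ ?_
    · rw [h₁₃, h22, ← hB, hc, hBeq]; ring
    · rw [h₁₃, h22, ← hB, hc, hBeq]; nlinarith [mul_nonneg hu0 hR0]

/-! ### Necessity of the parameter conditions -/

lemma exists_isGreatest_root {a₁ a₂ a₃ : ℂ} (h₁ : a₁ ≠ 0) (h₂ : a₂ ≠ 0) (h₃ : a₃ ≠ 0)
    {θ s₁ s₂ s₃ : ℝ} (hs₁ : s₁ = (reciprocalMean a₁ + Real.cos (2 * θ)) / 2)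
    (hs₂ : s₂ = (reciprocalMean a₂ + Real.cos (2 * θ)) / 2)
    (hs₃ : s₃ = (reciprocalMean a₃ + Real.cos (2 * θ)) / 2) :
    ∃ m, IsGreatest (directionalPart θ '' numericalRange (reciprocalMatrix a₁ a₂ a₃)) m ∧
      m ^ 4 - (s₁ + s₂ + s₃) * m ^ 2 + s₁ * s₃ = 0 := by
  have hc := Real.neg_one_le_cos (2 * θ)
  have k₁ : 0 ≤ s₁ := by linarith [one_le_reciprocalMean h₁]
  have k₂ : 0 ≤ s₂ := by linarith [one_le_reciprocalMean h₂]
  have k₃ : 0 ≤ s₃ := by linarith [one_le_reciprocalMean h₃]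
  have hD : 0 ≤ (s₁ + s₂ + s₃) ^ 2 - 4 * (s₁ * s₃) := by
    nlinarith [sq_nonneg (s₁ - s₃), mul_nonneg k₁ k₂, mul_nonneg k₂ k₃, sq_nonneg s₂]
  set d := √((s₁ + s₂ + s₃) ^ 2 - 4 * (s₁ * s₃)) with hd
  have hd0 : 0 ≤ d := Real.sqrt_nonneg _
  have hd2 : d ^ 2 = (s₁ + s₂ + s₃) ^ 2 - 4 * (s₁ * s₃) := Real.sq_sqrt hD
  have hm2 : √((s₁ + s₂ + s₃ + d) / 2) ^ 2 = (s₁ + s₂ + s₃ + d) / 2 :=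
    Real.sq_sqrt (by positivity)
  have hroot : √((s₁ + s₂ + s₃ + d) / 2) ^ 4
      - (s₁ + s₂ + s₃) * √((s₁ + s₂ + s₃ + d) / 2) ^ 2 + s₁ * s₃ = 0 := by
    rw [show (4 : ℕ) = 2 * 2 from rfl, pow_mul, hm2]
    linear_combination hd2 / 4
  exact ⟨_, isGreatest_directionalPart_numericalRange h₁ h₂ h₃ hs₁ hs₂ hs₃ (Real.sqrt_nonneg _)
    hroot (by rw [hm2]; linarith), hroot⟩

/-- The smoothness exponent `⊤` means analytic, so the identity theorem applies on ℝ. -/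
lemma contDiff_omega_eq_zero_of_eventually {f : ℝ → ℝ} (hf : ContDiff ℝ ⊤ f) {t : ℝ}
    (h : ∀ᶠ s in nhds t, f s = 0) (s : ℝ) : f s = 0 := by
  have := (contDiff_omega_iff_analyticOnNhd.1 hf).eq_of_eventuallyEq
    (contDiff_omega_iff_analyticOnNhd.1 (contDiff_const (c := (0 : ℝ)))) h
  exact congrFun this s

lemma contDiff_directionalPart (c : ℂ) : ContDiff ℝ ⊤ fun θ => directionalPart θ c := by
  unfold directionalPart; fun_prop

/-- The support function of an ellipse whose center is not the origin can satisfy the characteristic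
equation of the hermitian parts only for the parameters of a bi-elliptical numerical range. -/
lemma parameters_of_ellipse_root {A₁ A₂ A₃ : ℝ} (hA₁ : 1 ≤ A₁) (hA₂ : 1 ≤ A₂) (hA₃ : 1 ≤ A₃)
    {c : ℂ} (hc : c ≠ 0) {Q : ℝ → ℝ} (hQ : ContDiff ℝ ⊤ Q) (hQpos : ∀ θ, 0 < Q θ)
    (hQper : ∀ θ, Q (θ + Real.pi) = Q θ) {t : ℝ}
    (h : ∀ᶠ θ in nhds t, (directionalPart θ c + √(Q θ)) ^ 4
      - ((A₁ + Real.cos (2 * θ)) / 2 + (A₂ + Real.cos (2 * θ)) / 2 + (A₃ + Real.cos (2 * θ)) / 2)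
        * (directionalPart θ c + √(Q θ)) ^ 2
      + (A₁ + Real.cos (2 * θ)) / 2 * ((A₃ + Real.cos (2 * θ)) / 2) = 0) :
    (A₁ = A₃ ∧ 1 < A₃) ∧ A₂ = 1 := by
  have hl := contDiff_directionalPart c
  have hsq : ContDiff ℝ ⊤ fun θ => √(Q θ) := hQ.sqrt fun θ => (hQpos θ).ne'
  have hall := contDiff_omega_eq_zero_of_eventually (by fun_prop) h
  -- Passing to θ + π flips the sign of ℓ and fixes Q and cos 2θ; the two root equations are
  -- subtracted.
  have hodd : ∀ θ, directionalPart θ c * (2 * directionalPart θ c ^ 2 + 2 * Q θ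
      - (A₁ + A₂ + A₃ + 3 * Real.cos (2 * θ)) / 2) = 0 := by
    intro θ
    have e1 := hall θ
    have e2 := hall (θ + Real.pi)
    have hcos : Real.cos (2 * (θ + Real.pi)) = Real.cos (2 * θ) := by
      rw [mul_add, Real.cos_add_two_pi]
    rw [directionalPart_add_pi, hQper, hcos] at e2
    have hs := Real.sq_sqrt (hQpos θ).le
    have hs0 : √(Q θ) ≠ 0 := (Real.sqrt_pos.2 (hQpos θ)).ne'
    have : √(Q θ) * (directionalPart θ c * (2 * directionalPart θ c ^ 2 + 2 * Q θ
      - (A₁ + A₂ + A₃ + 3 * Real.cos (2 * θ)) / 2)) = 0 := by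
      linear_combination e1 / 4 - e2 / 4 - 2 * directionalPart θ c * √(Q θ) * hs
    exact (mul_eq_zero.1 this).resolve_left hs0
  -- Near arg c the factor ℓ is nonzero and can be cancelled; analyticity extends the result to all
  -- θ.
  have hsum : ∀ θ, 2 * directionalPart θ c ^ 2 + 2 * Q θ
      - (A₁ + A₂ + A₃ + 3 * Real.cos (2 * θ)) / 2 = 0 := by
    have hne : directionalPart (Complex.arg c) c ≠ 0 := by
      rw [directionalPart, ← Complex.norm_mul_cos_arg c, ← Complex.norm_mul_sin_arg c]
      have : ‖c‖ ≠ 0 := norm_ne_zero_iff.2 hc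
      convert this using 1
      simp only [Complex.norm_mul_cos_arg, Complex.norm_mul_sin_arg]
      linear_combination (-Real.cos (Complex.arg c)) * Complex.norm_mul_cos_arg c
        - Real.sin (Complex.arg c) * Complex.norm_mul_sin_arg c
        + ‖c‖ * Real.sin_sq_add_cos_sq (Complex.arg c)
    refine contDiff_omega_eq_zero_of_eventually (t := Complex.arg c) (by fun_prop) ?_
    filter_upwards [hl.continuous.continuousAt.eventually_ne hne] with θ hθ
    exact (mul_eq_zero.1 (hodd θ)).resolve_left hθ
  have hprod : ∀ θ, (directionalPart θ c ^ 2 - Q θ) ^ 2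
      = (A₁ + Real.cos (2 * θ)) / 2 * ((A₃ + Real.cos (2 * θ)) / 2) := by
    intro θ
    have hs := Real.sq_sqrt (hQpos θ).le
    have e := hall θ
    have e' := hsum θ
    set l := directionalPart θ c
    set r := √(Q θ)
    rw [← hs] at e' ⊢
    linear_combination -e + (l + r) ^ 2 * e'
  have hU : ∀ θ, (8 * directionalPart θ c ^ 2 - (A₁ + A₂ + A₃) - 3 * Real.cos (2 * θ)) ^ 2
      = 4 * (A₁ + Real.cos (2 * θ)) * (A₃ + Real.cos (2 * θ)) := by
    intro θ
    have e := hprod θ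
    have e' := hsum θ
    have hQe : Q θ = (A₁ + A₂ + A₃ + 3 * Real.cos (2 * θ)) / 4 - directionalPart θ c ^ 2 := by
      linarith
    rw [hQe] at e
    linear_combination 16 * e
  have hdir : ∀ θ, directionalPart θ c ^ 2 = (c.re ^ 2 + c.im ^ 2) / 2
      + (c.re ^ 2 - c.im ^ 2) / 2 * Real.cos (2 * θ) + c.re * c.im * Real.sin (2 * θ) := by
    intro θ
    rw [directionalPart, Real.cos_two_mul, Real.sin_two_mul]
    linear_combination c.im ^ 2 * Real.sin_sq_add_cos_sq θ
  set U := 4 * (c.re ^ 2 + c.im ^ 2) - (A₁ + A₂ + A₃) with hUdef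
  set V := 4 * (c.re ^ 2 - c.im ^ 2) - 3 with hVdef
  set W := 8 * (c.re * c.im) with hWdef
  -- Here x = cos 2θ and y = sin 2θ range over the whole unit circle.
  have hpoly : ∀ x y : ℝ, x ^ 2 + y ^ 2 = 1 →
      (U + V * x + W * y) ^ 2 = 4 * (A₁ + x) * (A₃ + x) := by
    intro x y hxy
    have hn : ‖(⟨x, y⟩ : ℂ)‖ = 1 := by
      rw [Complex.norm_def, Complex.normSq_mk, ← sq, ← sq, hxy, Real.sqrt_one]
    have h1 := Complex.norm_mul_cos_arg (⟨x, y⟩ : ℂ)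
    have h2 := Complex.norm_mul_sin_arg (⟨x, y⟩ : ℂ)
    rw [hn, one_mul] at h1 h2
    have e := hU (Complex.arg ⟨x, y⟩ / 2)
    rw [hdir, mul_div_cancel₀ _ two_ne_zero, h1, h2] at e
    simp only at e
    rw [← e, hUdef, hVdef, hWdef]; ring
  have e1 := hpoly 1 0 (by norm_num)
  have e2 := hpoly (-1) 0 (by norm_num)
  have e3 := hpoly 0 1 (by norm_num)
  have e4 := hpoly 0 (-1) (by norm_num)
  have e5 := hpoly (3 / 5) (4 / 5) (by norm_num)
  have e6 := hpoly (3 / 5) (-(4 / 5)) (by norm_num)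
  -- The right-hand side is even in y, so reflected points give UW = 0 and VW = 0; but U = V = 0
  -- fails at (1, 0).
  have hW : W = 0 := by
    by_contra hW
    have hU0 : U = 0 :=
      (mul_eq_zero.1 (by linear_combination e3 / 4 - e4 / 4 : U * W = 0)).resolve_right hW
    have hV0 : V = 0 := (mul_eq_zero.1
      (by rw [hU0] at e5 e6; linear_combination (25 / 48) * (e5 - e6) : V * W = 0)).resolve_right hW
    rw [hU0, hV0] at e1
    nlinarith
  rw [hW] at e1 e2 e3
  -- Now (U + Vx)² = 4(A₁ + x)(A₃ + x) at x = 0, ±1: the quadratic is a perfect square, so its roots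
  -- coincide.
  have hV2 : V ^ 2 = 4 := by linear_combination e1 / 2 + e2 / 2 - e3
  have hUV : U * V = 2 * (A₁ + A₃) := by linear_combination e1 / 4 - e2 / 4
  have hsqr : (A₁ - A₃) ^ 2 = 0 := by
    have : (U * V) ^ 2 = 16 * A₁ * A₃ := by
      rw [mul_pow, hV2]; linear_combination 4 * e3
    rw [hUV] at this
    linear_combination this / 4
  have h13 : A₁ = A₃ := by
    have := pow_eq_zero_iff two_ne_zero |>.1 hsqr
    linarith
  -- In the direction orthogonal to c, Q² = s₁² and 2Q = 2s₁ + s₂ give Q = s₁ and s₂ = 0. Hence A₂ =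
  -- -cos 2θ ≤ 1, so A₂ = 1, and Q > 0 gives A₃ > 1.
  obtain ⟨θ, hθ⟩ : ∃ θ, directionalPart θ c = 0 := by
    refine ⟨Complex.arg c + Real.pi / 2, ?_⟩
    rw [directionalPart, Real.cos_add_pi_div_two, Real.sin_add_pi_div_two]
    linear_combination Real.sin (Complex.arg c) * Complex.norm_mul_cos_arg c
        - Real.cos (Complex.arg c) * Complex.norm_mul_sin_arg c
  have f1 := hprod θ
  have f2 := hsum θ
  have hcos := Real.neg_one_le_cos (2 * θ)
  have hq := hQpos θ
  rw [hθ, h13] at f1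
  rw [hθ, h13] at f2
  have hQs : Q θ = (A₃ + Real.cos (2 * θ)) / 2 := by
    refine (pow_left_inj₀ hq.le (by linarith) two_ne_zero).1 ?_
    linear_combination f1
  refine ⟨⟨h13, by linarith⟩, by linarith⟩

lemma parameters_of_numericalRange_eq {a₁ a₂ a₃ : ℂ} (h₁ : a₁ ≠ 0) (h₂ : a₂ ≠ 0) (h₃ : a₃ ≠ 0)
    {E₁ E₂ : Set ℂ} {c₁ c₂ : ℂ} (hE₁ : IsEllipse E₁ c₁) (hE₂ : IsEllipse E₂ c₂) (hc : c₁ ≠ 0)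
    (hsub : ¬ E₁ ⊆ convexHull ℝ E₂)
    (hW : numericalRange (reciprocalMatrix a₁ a₂ a₃) = convexHull ℝ (E₁ ∪ E₂)) :
    (reciprocalMean a₁ = reciprocalMean a₃ ∧ 1 < reciprocalMean a₃) ∧ reciprocalMean a₂ = 1 := by
  obtain ⟨z, hz, hzn⟩ := Set.not_subset.1 hsub
  obtain ⟨t, ht⟩ := exists_directionalPart_lt (convex_convexHull ℝ E₂)
    hE₂.isCompact.convexHull_of_finiteDimensional.isClosed hzn
  obtain ⟨φ, p, q, hp, hq, rfl⟩ := hE₁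
  obtain ⟨ψ, p', q', -, -, rfl⟩ := hE₂
  have g₁ := isGreatest_directionalPart_ellipse c₁ φ p q
  have g₂ := isGreatest_directionalPart_ellipse c₂ ψ p' q'
  have hlt : directionalPart t c₂
        + √((p' * Real.cos (t - ψ)) ^ 2 + (q' * Real.sin (t - ψ)) ^ 2)
      < directionalPart t c₁ + √((p * Real.cos (t - φ)) ^ 2 + (q * Real.sin (t - φ)) ^ 2) := by
    obtain ⟨w, hw, hwm⟩ := (g₂ t).1
    rw [← hwm]
    exact (ht w (subset_convexHull ℝ _ hw)).trans_le ((g₁ t).2 ⟨z, hz, rfl⟩)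
  have k₁ := (contDiff_directionalPart c₁).continuous
  have k₂ := (contDiff_directionalPart c₂).continuous
  refine parameters_of_ellipse_root (one_le_reciprocalMean h₁) (one_le_reciprocalMean h₂)
    (one_le_reciprocalMean h₃) hc
    (Q := fun θ => (p * Real.cos (θ - φ)) ^ 2 + (q * Real.sin (θ - φ)) ^ 2) (by fun_prop)
    (fun θ => ?_) (fun θ => ?_) (t := t) ?_
  · rcases eq_or_ne (Real.cos (θ - φ)) 0 with h0 | h0
    · have : Real.sin (θ - φ) ≠ 0 := fun hs => by
        have := Real.sin_sq_add_cos_sq (θ - φ)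
        rw [h0, hs] at this; norm_num at this
      positivity
    · positivity
  · rw [show θ + Real.pi - φ = θ - φ + Real.pi by ring, Real.cos_add_pi, Real.sin_add_pi]; ring
  · have hev := ContinuousAt.eventually_lt (f := fun t => directionalPart t c₂
        + √((p' * Real.cos (t - ψ)) ^ 2 + (q' * Real.sin (t - ψ)) ^ 2))
      (g := fun t => directionalPart t c₁
        + √((p * Real.cos (t - φ)) ^ 2 + (q * Real.sin (t - φ)) ^ 2))
      (x₀ := t) (by fun_prop) (by fun_prop) hlt
    filter_upwards [hev] with θ hθ
    obtain ⟨m, hm, hroot⟩ := exists_isGreatest_root h₁ h₂ h₃ (θ := θ) rfl rfl rfl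
    have hmax := isGreatest_image_convexHull_union (g₁ θ) (g₂ θ)
    rw [max_eq_left hθ.le, ← hW] at hmax
    rw [← hm.unique hmax]
    exact hroot

theorem theorem6p1 (a₁ a₂ a₃ : ℂ) (h₁ : a₁ ≠ 0) (h₂ : a₂ ≠ 0) (h₃ : a₃ ≠ 0) :
    (IsBiElliptical (numericalRange (reciprocalMatrix a₁ a₂ a₃)) ↔
      (reciprocalMean a₁ = reciprocalMean a₃ ∧ 1 < reciprocalMean a₃) ∧ reciprocalMean a₂ = 1) ∧
    ((reciprocalMean a₁ = reciprocalMean a₃ ∧ 1 < reciprocalMean a₃) ↔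
      (‖a₁‖ = ‖a₃‖ ∧ ‖a₃‖ ≠ 1) ∨ (‖a₁‖ = ‖a₃‖⁻¹ ∧ ‖a₃‖⁻¹ ≠ 1)) ∧
    (reciprocalMean a₂ = 1 ↔ ‖a₂‖ = 1) := by
  refine ⟨⟨?_, fun ⟨⟨h₁₃, hlt⟩, h22⟩ => isBiElliptical_numericalRange h₁ h₂ h₃ h₁₃ hlt h22⟩,
    reciprocalMean_eq_and_one_lt_iff h₁ h₃, reciprocalMean_eq_one_iff h₂⟩
  rintro ⟨E₁, E₂, c₁, c₂, hE₁, hE₂, hc, hsub₁, hsub₂, hW⟩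
  -- The centers are distinct, so at least one is nonzero, and the hypotheses are symmetric in the
  -- two ellipses.
  by_cases hc₁ : c₁ = 0
  · refine parameters_of_numericalRange_eq h₁ h₂ h₃ hE₂ hE₁ (fun h => hc (hc₁.trans h.symm)) hsub₂ ?_
    rw [hW, Set.union_comm]
  · exact parameters_of_numericalRange_eq h₁ h₂ h₃ hE₁ hE₂ hc₁ hsub₁ hW
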